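/- Fix $\beta>0$, $x_0\in\mathbb R$, $d$ with $0<d<x_0$ (so that $I=[x_0-d,x_0+d]\subset(0,\infty)$) and $K>0$. For $L>0$ let $\mathscr C_\beta(L,I,K)$ be the set of all continuous functions $\gamma\in\mathbb L_1(\mathbb R)$ which are covariance functions of real stationary processes (i.e. every matrix $(\gamma(t_i-t_j))_{i,j}$ is symmetric positive semidefinite), such that (i) $\int_{-\infty}^\infty|\gamma(t)|\,dt\le K$, and (ii) with $\ell=\max\{k\in\mathbb N: k<\beta+1\}$, $\gamma$ is $\ell$ times continuously differentiable on $I$ and $|\gamma^{(\ell)}(x)-\gamma^{(\ell)}(x')|\le L|x-x'|^{\beta+1-\ell}$ for all $x,x'\in I$. For $\delta>0$, $n\in\mathbb N$ and $T=n\delta$, let $\mathrm P_\gamma$ be the law of the observation $X^n=(X(\delta),X(2\delta),\dots,X(n\delta))$ of a stationary zero-mean Gaussian process $X$ with covariance function $\gamma$, let $\mathrm E_\gamma$ be the corresponding expectation, and let $$\mathcal R^*=\mathcal R^*_{x_0}[\mathscr C_\beta(L,I,K)]=\inf_{\hat\theta}\ \sup_{\gamma\in\mathscr C_\beta(L,I,K)}\big[\mathrm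 E_\gamma|\hat\theta(X^n)-\gamma'(x_0)|^2\big]^{1/2},$$ where the infimum is over all real-valued measurable functions $\hat\theta$ of $X^n$. Then there are constants $C_1,C_2,c>0$ depending only on $\beta,x_0,d,K$ such that the following holds for every $L>0$: if $T\to\infty$ with $n$ and $\delta$ varying with $T=n\delta$ in such a way that $$C_1\delta^{-2}\le T,\qquad L^2T\le C_2\,\delta^{-2\beta-2},$$ then $$\liminf_{T\to\infty}\Big\{L^{-1/(\beta+1)}\,T^{\beta/(2\beta+2)}\ \mathcal R^*_{x_0}[\mathscr C_\beta(L,I,K)]\Big\}\ \ge\ c .$$ -/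

import Mathlib

open MeasureTheory ProbabilityTheory Filter Topology
open scoped ENNReal

/-- `γ` is the covariance function of a (mean-square continuous) stationary process on `ℝ`:
it is continuous and all the matrices `(γ (t i - t j))` are symmetric and positive semidefinite. -/
def IsCovarianceFunction (γ : ℝ → ℝ) : Prop :=
  Continuous γ ∧
    ∀ (m : ℕ) (t : Fin m → ℝ), (Matrix.of fun i j => γ (t i - t j)).PosSemidef

/-- For `β > 0`, the largest natural number strictly less than `β + 1`. -/
noncomputable def smoothnessOrder (β : ℝ) : ℕ := ⌈β⌉₊

theorem isGreatest_smoothnessOrder {β : ℝ} (hβ : 0 < β) :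
    IsGreatest {k : ℕ | (k : ℝ) < β + 1} (smoothnessOrder β) := by
  refine ⟨Nat.ceil_lt_add_one hβ.le, fun k hk => ?_⟩
  have h : (k : ℝ) < (⌈β⌉₊ : ℝ) + 1 := lt_of_lt_of_le hk (by linarith [Nat.le_ceil β])
  have h' : k < ⌈β⌉₊ + 1 := by exact_mod_cast h
  exact Nat.lt_succ_iff.mp h'

/-- The class `𝒞_β(L, I, K)` of covariance functions, `I = [x₀ - d, x₀ + d]`: the `L¹(ℝ)` norm is at
most `K`, and with `ℓ = smoothnessOrder β` the function is `C^ℓ` on `I` and its `ℓ`-th derivative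
is Hölder continuous on `I` with exponent `β + 1 - ℓ` and constant `L`
(derivatives at the end points of `I` are one-sided). -/
def covClass (β L x₀ d K : ℝ) : Set (ℝ → ℝ) :=
  {γ | IsCovarianceFunction γ ∧
    Integrable γ volume ∧ ∫ t, |γ t| ≤ K ∧
    ContDiffOn ℝ (smoothnessOrder β : ℕ) γ (Set.Icc (x₀ - d) (x₀ + d)) ∧
    ∀ x ∈ Set.Icc (x₀ - d) (x₀ + d), ∀ y ∈ Set.Icc (x₀ - d) (x₀ + d),
      |iteratedDerivWithin (smoothnessOrder β) γ (Set.Icc (x₀ - d) (x₀ + d)) x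
        - iteratedDerivWithin (smoothnessOrder β) γ (Set.Icc (x₀ - d) (x₀ + d)) y|
        ≤ L * |x - y| ^ (β + 1 - (smoothnessOrder β : ℝ))}

/-- The grid points `δ, 2δ, …, nδ`, indexed by `Fin n`. -/
def gridPoint (n : ℕ) (δ : ℝ) (i : Fin n) : ℝ := ((i : ℕ) + 1 : ℝ) * δ

/-- The law `P_γ` of the observation `(X(δ), X(2δ), …, X(nδ))`, where `X` is a stationary zero-mean
Gaussian process with covariance function `γ`. -/
noncomputable def sampleLaw (n : ℕ) (δ : ℝ) (γ : ℝ → ℝ) :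
    Measure (EuclideanSpace ℝ (Fin n)) :=
  multivariateGaussian 0 (Matrix.of fun i j => γ (gridPoint n δ i - gridPoint n δ j))

/-- The maximal root-mean-square risk over the class `C` of an estimator `θ` of `γ'(x₀)`. -/
noncomputable def derivMaxRisk (n : ℕ) (δ x₀ : ℝ) (C : Set (ℝ → ℝ))
    (θ : EuclideanSpace ℝ (Fin n) → ℝ) : ℝ≥0∞ :=
  ⨆ γ ∈ C, (∫⁻ x, ENNReal.ofReal (|θ x - deriv γ x₀| ^ 2) ∂(sampleLaw n δ γ)) ^ (1 / 2 : ℝ)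

/-- The minimax risk over the class `C`: the infimum of `derivMaxRisk` over all estimators, that is, all
measurable functions of the observation. -/
noncomputable def derivMinimaxRisk (n : ℕ) (δ x₀ : ℝ) (C : Set (ℝ → ℝ)) : ℝ≥0∞ :=
  ⨅ (θ : EuclideanSpace ℝ (Fin n) → ℝ) (_ : Measurable θ), derivMaxRisk n δ x₀ C θ

open scoped NNReal RealInnerProductSpace

/-! The bound comes from two covariance functions whose sample laws are hard to tell apart but whose
derivatives at `x₀` differ. The null one, `triangleCov`, is a triangle supported in `[-δ, δ]` that
spends at most half of the budget `K`. It vanishes on `I` once `δ < x₀ - d`, and on the grid it is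
white noise of large variance `K / (4δ)`. The alternative adds `ε q` with `q = tiltedCov a V x₀`, a
positive definite function containing the wave packet `sin (a (t - x₀))` under a Gaussian envelope
of fixed width centred at `x₀`. Its slope at `x₀` is at least `a / 2` (`half_le_deriv_tiltedCov`)
and its Hölder seminorm of order `β + 1` is `O(a ^ (β + 1))` (`exists_holder_bound_tiltedCov`),
whereas its envelope, hence its `L¹` norm and its square sums over the grid, do not grow with `a`.

The laws are compared through the second moment of the likelihood ratio
(`lintegral_multivariateGaussian_smul_one_le`), which is governed by the squared Frobenius norm of
the perturbation over the squared noise variance. The former is `O(ε² n / δ)` by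
`exists_sum_sq_tiltedCov_le`, the latter is of order `δ⁻²`, so the quotient is `O(ε² T)`. Taking `ε
= T ^ (-1/2)` keeps it bounded, and `a ^ (β + 1) = (L / M) T ^ (1/2)` exhausts the smoothness
budget. The separation `ε a / 2` is then of order `L ^ (1/(β+1)) T ^ (-β/(2β+2))`, and
`derivMinimaxRisk_two_point` turns it into a risk bound. -/

/-! ### Likelihood ratios of Gaussian vectors. -/

theorem lintegral_pi_prod_eq_prod {ι : Type*} [Fintype ι] {Ω : ι → Type*}
    [∀ i, MeasurableSpace (Ω i)] (μ : ∀ i, Measure (Ω i)) [∀ i, IsProbabilityMeasure (μ i)]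
    {f : ∀ i, Ω i → ℝ≥0∞} (hf : ∀ i, Measurable (f i)) :
    ∫⁻ x, ∏ i, f i (x i) ∂Measure.pi μ = ∏ i, ∫⁻ x, f i x ∂μ i := by
  refine (lintegral_prod_eq_prod_lintegral_of_indepFun Finset.univ (fun i (x : ∀ i, Ω i) => f i (x i))
    (iIndepFun_pi fun i => (hf i).aemeasurable)
    (fun i => (hf i).comp (measurable_pi_apply i))).trans ?_
  refine Finset.prod_congr rfl fun i _ => ?_
  exact (measurePreserving_eval μ i).lintegral_comp (hf i)

theorem pi_eq_withDensity_prod {ι : Type*} [Fintype ι] {Ω : ι → Type*}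
    [∀ i, MeasurableSpace (Ω i)] (μ ν : ∀ i, Measure (Ω i)) [∀ i, IsProbabilityMeasure (μ i)]
    [∀ i, IsProbabilityMeasure (ν i)] {f : ∀ i, Ω i → ℝ≥0∞} (hf : ∀ i, Measurable (f i))
    (h : ∀ i, ν i = (μ i).withDensity (f i)) :
    Measure.pi ν = (Measure.pi μ).withDensity fun x => ∏ i, f i (x i) := by
  refine Measure.pi_eq fun s hs => ?_
  rw [withDensity_apply _ (MeasurableSet.univ_pi hs),
    ← lintegral_indicator (MeasurableSet.univ_pi hs)]
  have h1 : ∀ x : ∀ i, Ω i, (Set.univ.pi s).indicator (fun x => ∏ i, f i (x i)) x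
      = ∏ i, (s i).indicator (f i) (x i) := by
    intro x
    by_cases hx : x ∈ Set.univ.pi s
    · rw [Set.indicator_of_mem hx]
      exact Finset.prod_congr rfl fun i _ => by rw [Set.indicator_of_mem (hx i (Set.mem_univ i))]
    · rw [Set.indicator_of_notMem hx]
      have : ∃ i, x i ∉ s i := by
        by_contra hc
        push Not at hc
        exact hx fun i _ => hc i
      obtain ⟨i, hi⟩ := this
      exact (Finset.prod_eq_zero (Finset.mem_univ i) (Set.indicator_of_notMem hi _)).symm
  simp_rw [h1]
  rw [lintegral_pi_prod_eq_prod μ fun i => (hf i).indicator (hs i)]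
  refine Finset.prod_congr rfl fun i _ => ?_
  rw [lintegral_indicator (hs i), h i, withDensity_apply _ (hs i)]

theorem gaussianReal_eq_withDensity {v w : ℝ≥0} (hv : v ≠ 0) (hw : w ≠ 0) :
    gaussianReal 0 v
      = (gaussianReal 0 w).withDensity fun x => gaussianPDF 0 v x / gaussianPDF 0 w x := by
  rw [gaussianReal_of_var_ne_zero _ hw, ← withDensity_mul₀ (by fun_prop) (by fun_prop),
    gaussianReal_of_var_ne_zero _ hv]
  congr 1
  ext x
  simp only [Pi.mul_apply]
  rw [mul_comm, ENNReal.div_mul_cancel (gaussianPDF_pos 0 hw x).ne' gaussianPDF_ne_top]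

/-- The exponents combine through `2 / v - 1 / w = (2w - v) / (vw)`, which is positive because `v ≤
w`; the prefactor is therefore the second moment of the likelihood ratio. -/
theorem gaussianPDFReal_sq_div {v w : ℝ} (hv : 0 < v) (hw : v ≤ w) (x : ℝ) :
    gaussianPDFReal 0 v.toNNReal x ^ 2 / gaussianPDFReal 0 w.toNNReal x
      = √(w ^ 2 / (v * (2 * w - v)))
        * gaussianPDFReal 0 (v * w / (2 * w - v)).toNNReal x := by
  have hw0 : 0 < w := hv.trans_le hw
  have h2 : 0 < 2 * w - v := by linarith
  have hu : 0 < v * w / (2 * w - v) := by positivity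
  have hpi := Real.pi_pos
  simp only [gaussianPDFReal, Real.coe_toNNReal _ hv.le, Real.coe_toNNReal _ hw0.le,
    Real.coe_toNNReal _ hu.le, sub_zero]
  have e1 : Real.exp (-x ^ 2 / (2 * v)) ^ 2
      = Real.exp (-x ^ 2 / (2 * (v * w / (2 * w - v)))) * Real.exp (-x ^ 2 / (2 * w)) := by
    rw [← Real.exp_add, ← Real.exp_nat_mul]
    congr 1
    field_simp
    push_cast
    ring
  have e2 : (√(2 * Real.pi * v))⁻¹ ^ 2
      = √(w ^ 2 / (v * (2 * w - v))) * (√(2 * Real.pi * (v * w / (2 * w - v))))⁻¹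
        * (√(2 * Real.pi * w))⁻¹ := by
    rw [inv_pow, Real.sq_sqrt (by positivity), ← Real.sqrt_inv, ← Real.sqrt_inv,
      ← Real.sqrt_mul (by positivity), ← Real.sqrt_mul (by positivity)]
    symm
    rw [Real.sqrt_eq_iff_mul_self_eq (by positivity) (by positivity)]
    field_simp
    exact div_self (by linarith)
  have e3 : 0 < √(2 * Real.pi * w) := by positivity
  rw [mul_pow, e1, e2, div_eq_iff (by positivity)]
  ring

theorem lintegral_gaussianPDF_div_sq_le {v w : ℝ} (hv : 0 < v) (hw : v ≤ w) :
    ∫⁻ x, (gaussianPDF 0 v.toNNReal x / gaussianPDF 0 w.toNNReal x) ^ 2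
        ∂gaussianReal 0 w.toNNReal ≤ ENNReal.ofReal (Real.exp (((w - v) / v) ^ 2 / 2)) := by
  have hw0 : 0 < w := hv.trans_le hw
  have h2 : 0 < 2 * w - v := by linarith
  have hu : 0 < v * w / (2 * w - v) := by positivity
  have hwn : w.toNNReal ≠ 0 := by simpa using hw0
  have hun : (v * w / (2 * w - v)).toNNReal ≠ 0 := by simpa using hu
  rw [gaussianReal_of_var_ne_zero _ hwn,
    lintegral_withDensity_eq_lintegral_mul _ (by fun_prop) (by fun_prop)]
  have key : ∀ x, (gaussianPDF 0 w.toNNReal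
      * fun x => (gaussianPDF 0 v.toNNReal x / gaussianPDF 0 w.toNNReal x) ^ 2) x
      = ENNReal.ofReal √(w ^ 2 / (v * (2 * w - v)))
        * gaussianPDF 0 (v * w / (2 * w - v)).toNNReal x := by
    intro x
    have hp := gaussianPDFReal_pos 0 w.toNNReal x hwn
    have hp' := gaussianPDFReal_nonneg 0 v.toNNReal x
    simp only [Pi.mul_apply, gaussianPDF]
    rw [← ENNReal.ofReal_div_of_pos hp, ← ENNReal.ofReal_pow (by positivity),
      ← ENNReal.ofReal_mul hp.le, ← ENNReal.ofReal_mul (by positivity),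
      ← gaussianPDFReal_sq_div hv hw]
    congr 1
    field_simp
  simp_rw [key]
  rw [lintegral_const_mul _ (by fun_prop), lintegral_gaussianPDF_eq_one 0 hun, mul_one]
  refine ENNReal.ofReal_le_ofReal (Real.sqrt_le_iff.mpr ⟨(Real.exp_pos _).le, ?_⟩)
  rw [← Real.exp_nat_mul]
  -- After clearing denominators the gap is a positive multiple of `(w - v) ^ 3`. Then `1 + x ≤ exp
  -- x`, and the square root halves the exponent.
  have h3 : w ^ 2 / (v * (2 * w - v)) ≤ ((w - v) / v) ^ 2 + 1 := by
    rw [div_pow, div_add_one (by positivity), div_le_div_iff₀ (by positivity) (by positivity)]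
    have : 0 ≤ v * (w - v) ^ 3 := by
      have : 0 ≤ w - v := by linarith
      positivity
    nlinarith
  refine h3.trans ((Real.add_one_le_exp _).trans_eq ?_)
  congr 1
  push_cast
  ring

/-- Characteristic functions agree: hypothesis `h` says that `b` diagonalises the quadratic form of
`S` with weights `w`. -/
theorem map_pi_gaussianReal_eq_multivariateGaussian {ι : Type*} [Fintype ι] [DecidableEq ι]
    (b : OrthonormalBasis ι ℝ (EuclideanSpace ℝ ι)) {S : Matrix ι ι ℝ} (hS : S.PosSemidef)
    (w : ι → ℝ≥0)
    (h : ∀ t : EuclideanSpace ℝ ι, t ⬝ᵥ S.mulVec t = ∑ i, (w i : ℝ) * ⟪b i, t⟫ ^ 2) :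
    (Measure.pi fun i => gaussianReal 0 (w i)).map (fun x => ∑ i, x i • b i)
      = multivariateGaussian 0 S := by
  have hm : Measurable fun x : ι → ℝ => ∑ i, x i • b i := by fun_prop
  have := Measure.isProbabilityMeasure_map (μ := Measure.pi fun i => gaussianReal 0 (w i))
    hm.aemeasurable
  refine Measure.ext_of_charFun (E := EuclideanSpace ℝ ι) ?_
  ext t
  rw [charFun_multivariateGaussian hS, h, charFun_apply,
    integral_map hm.aemeasurable (Measurable.aestronglyMeasurable (by fun_prop))]
  simp_rw [sum_inner, Complex.ofReal_sum, Finset.sum_mul, Complex.exp_sum]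
  rw [integral_fintype_prod_eq_prod
    (f := fun i (x : ℝ) ↦ Complex.exp (((⟪x • b i, t⟫ : ℝ) : ℂ) * Complex.I))]
  simp_rw [real_inner_smul_left, mul_comm _ (⟪_, t⟫), Complex.ofReal_mul,
    ← charFun_apply_real, charFun_gaussianReal]
  rw [← Complex.exp_sum]
  congr 1
  simp [Finset.sum_div]

/-- Both sides equal the trace of `D * D`. -/
theorem sum_sq_eigenvalues {ι : Type*} [Fintype ι] [DecidableEq ι] {D : Matrix ι ι ℝ}
    (hD : D.IsHermitian) : ∑ i, hD.eigenvalues i ^ 2 = ∑ i, ∑ j, D i j ^ 2 := by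
  have h1 : (D * D).trace = ∑ i, hD.eigenvalues i ^ 2 := by
    conv_lhs => rw [hD.spectral_theorem]
    rw [← map_mul, Matrix.diagonal_mul_diagonal, Unitary.conjStarAlgAut_apply, Matrix.trace_mul_comm,
      ← mul_assoc]
    simp [Matrix.trace_diagonal, sq]
  rw [← h1, Matrix.trace]
  refine Finset.sum_congr rfl fun i _ => ?_
  rw [Matrix.diag_apply, Matrix.mul_apply]
  refine Finset.sum_congr rfl fun j _ => ?_
  have := hD.apply i j
  simp at this
  rw [sq, this]

theorem dotProduct_mulVec_eq_sum_eigenvalues {ι : Type*} [Fintype ι] [DecidableEq ι]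
    {D : Matrix ι ι ℝ} (hD : D.IsHermitian) (t : EuclideanSpace ℝ ι) :
    t ⬝ᵥ D.mulVec t = ∑ i, hD.eigenvalues i * ⟪hD.eigenvectorBasis i, t⟫ ^ 2 := by
  have h1 : t ⬝ᵥ D.mulVec t = ⟪t, Matrix.toEuclideanCLM (𝕜 := ℝ) D t⟫ := by
    rw [Matrix.inner_toEuclideanCLM]
  rw [h1, ← hD.eigenvectorBasis.sum_inner_mul_inner]
  refine Finset.sum_congr rfl fun i _ => ?_
  have h2 : ⟪hD.eigenvectorBasis i, Matrix.toEuclideanCLM (𝕜 := ℝ) D t⟫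
      = hD.eigenvalues i * ⟪hD.eigenvectorBasis i, t⟫ := by
    have h3 : (hD.eigenvectorBasis i).ofLp ⬝ᵥ D.mulVec t.ofLp
        = (D.mulVec (hD.eigenvectorBasis i).ofLp) ⬝ᵥ t.ofLp := by
      rw [Matrix.dotProduct_mulVec, ← Matrix.mulVec_transpose]
      have : D.transpose = D := by simpa using hD.eq
      rw [this]
    rw [Matrix.inner_toEuclideanCLM]
    rw [h3, hD.mulVec_eigenvectorBasis, smul_dotProduct, smul_eq_mul,
      EuclideanSpace.inner_eq_star_dotProduct, dotProduct_comm t.ofLp]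
    simp
  rw [h2, real_inner_comm t]
  ring

/-- The second moment, under the law with the larger covariance, of the likelihood ratio of white
noise against a Gaussian vector controls the change of measure. -/
theorem lintegral_multivariateGaussian_smul_one_le {ι : Type*} [Fintype ι] [DecidableEq ι]
    {D : Matrix ι ι ℝ} (hD : D.PosSemidef) {v : ℝ} (hv : 0 < v)
    {f : EuclideanSpace ℝ ι → ℝ≥0∞} (hf : Measurable f) :
    ∫⁻ x, f x ∂multivariateGaussian 0 (v • (1 : Matrix ι ι ℝ))
      ≤ ENNReal.ofReal (Real.exp ((∑ i, ∑ j, D i j ^ 2) / v ^ 2 / 2)) ^ (1 / 2 : ℝ)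
        * (∫⁻ x, f x ^ 2 ∂multivariateGaussian 0 (v • (1 : Matrix ι ι ℝ) + D)) ^ (1 / 2 : ℝ) := by
  set b := hD.1.eigenvectorBasis
  set l := hD.1.eigenvalues
  have hl : ∀ i, 0 ≤ l i := hD.eigenvalues_nonneg
  set w : ι → ℝ≥0 := fun i => (v + l i).toNNReal
  have hvpsd : (v • (1 : Matrix ι ι ℝ)).PosSemidef := Matrix.PosSemidef.one.smul hv.le
  -- A multiple of the identity is diagonal in every orthonormal basis, so the eigenbasis of `D`
  -- presents both laws as images of product measures under one map.
  have hone : ∀ t : EuclideanSpace ℝ ι,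
      t ⬝ᵥ (v • (1 : Matrix ι ι ℝ)).mulVec t = ∑ i, v * ⟪b i, t⟫ ^ 2 := by
    intro t
    rw [← Finset.mul_sum, b.sum_sq_inner_right, EuclideanSpace.real_norm_sq_eq,
      Matrix.smul_mulVec, Matrix.one_mulVec, dotProduct_smul, smul_eq_mul]
    simp [dotProduct, sq]
  have h0 : (Measure.pi fun _ : ι => gaussianReal 0 v.toNNReal).map (fun x => ∑ i, x i • b i)
      = multivariateGaussian 0 (v • (1 : Matrix ι ι ℝ)) := by
    refine map_pi_gaussianReal_eq_multivariateGaussian b hvpsd (fun _ => v.toNNReal) fun t => ?_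
    rw [hone]
    simp [hv.le]
  have h1 : (Measure.pi fun i : ι => gaussianReal 0 (w i)).map (fun x => ∑ i, x i • b i)
      = multivariateGaussian 0 (v • (1 : Matrix ι ι ℝ) + D) := by
    refine map_pi_gaussianReal_eq_multivariateGaussian b (hvpsd.add hD) w fun t => ?_
    rw [Matrix.add_mulVec, dotProduct_add, hone, dotProduct_mulVec_eq_sum_eigenvalues hD.1,
      ← Finset.sum_add_distrib]
    refine Finset.sum_congr rfl fun i _ => ?_
    simp only [w]
    rw [Real.coe_toNNReal _ (by linarith [hl i])]
    ring
  have hm : Measurable fun x : ι → ℝ => ∑ i, x i • b i := by fun_prop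
  have hvn : v.toNNReal ≠ 0 := by simpa using hv
  have hwn : ∀ i, w i ≠ 0 := fun i => by
    have : 0 < v + l i := by linarith [hl i]
    simpa [w] using this
  set r : ι → ℝ → ℝ≥0∞ := fun i x => gaussianPDF 0 v.toNNReal x / gaussianPDF 0 (w i) x
  have hr : ∀ i, Measurable (r i) := fun i => by fun_prop
  have hpi := pi_eq_withDensity_prod (fun i => gaussianReal 0 (w i))
    (fun _ => gaussianReal 0 v.toNNReal) hr fun i => gaussianReal_eq_withDensity hvn (hwn i)
  have hrm : Measurable fun x : ι → ℝ => ∏ i, r i (x i) :=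
    Finset.measurable_prod _ fun i _ => (hr i).comp (measurable_pi_apply i)
  rw [← h0, ← h1, lintegral_map hf hm, lintegral_map (hf.pow_const 2) hm, hpi,
    lintegral_withDensity_eq_lintegral_mul _ hrm (g := fun x => f (∑ i, x i • b i)) (hf.comp hm)]
  -- Cauchy–Schwarz under the law with the larger covariance; the second moment of the ratio then
  -- factorises over the coordinates.
  refine (ENNReal.lintegral_mul_le_Lp_mul_Lq _ Real.HolderConjugate.two_two hrm.aemeasurable
    (hf.comp hm).aemeasurable).trans ?_
  simp only [ENNReal.rpow_two, Function.comp_apply]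
  gcongr
  simp_rw [← Finset.prod_pow]
  rw [lintegral_pi_prod_eq_prod (fun i => gaussianReal 0 (w i)) (f := fun i x => r i x ^ 2)
    fun i => (hr i).pow_const 2]
  have h2 : ∀ i, ∫⁻ x, r i x ^ 2 ∂gaussianReal 0 (w i)
      ≤ ENNReal.ofReal (Real.exp ((l i / v) ^ 2 / 2)) := by
    intro i
    have := lintegral_gaussianPDF_div_sq_le hv (w := v + l i) (by linarith [hl i])
    rwa [add_sub_cancel_left] at this
  refine (Finset.prod_le_prod' fun i _ => h2 i).trans_eq ?_
  rw [← ENNReal.ofReal_prod_of_nonneg fun i _ => (Real.exp_pos _).le, ← Real.exp_sum,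
    ← sum_sq_eigenvalues hD.1]
  simp_rw [div_pow, Finset.sum_div]
  rfl

/-! ### Constructing covariance functions. -/

theorem posSemidef_of_symm_of_sum_nonneg {m : ℕ} {M : Matrix (Fin m) (Fin m) ℝ}
    (hM : ∀ i j, M j i = M i j) (h : ∀ x : Fin m → ℝ, 0 ≤ ∑ i, ∑ j, x i * x j * M i j) :
    M.PosSemidef := by
  refine Matrix.PosSemidef.of_dotProduct_mulVec_nonneg ?_ fun x => ?_
  · ext i j
    simpa using hM i j
  · refine (h x).trans_eq ?_
    simp only [dotProduct, Matrix.mulVec, star_trivial, Finset.mul_sum]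
    exact Finset.sum_congr rfl fun i _ => Finset.sum_congr rfl fun j _ => by ring

theorem IsCovarianceFunction.add {γ₁ γ₂ : ℝ → ℝ} (h₁ : IsCovarianceFunction γ₁)
    (h₂ : IsCovarianceFunction γ₂) : IsCovarianceFunction (fun t => γ₁ t + γ₂ t) :=
  ⟨h₁.1.add h₂.1, fun m t => (h₁.2 m t).add (h₂.2 m t)⟩

theorem IsCovarianceFunction.const_mul {γ : ℝ → ℝ} (h : IsCovarianceFunction γ) {c : ℝ}
    (hc : 0 ≤ c) : IsCovarianceFunction (fun t => c * γ t) :=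
  ⟨h.1.const_mul c, fun m t => (h.2 m t).smul hc⟩

theorem re_charFun_eq_integral_cos (ν : Measure ℝ) [IsFiniteMeasure ν] (t : ℝ) :
    (charFun ν t).re = ∫ x, Real.cos (t * x) ∂ν := by
  have hi : Integrable (fun x : ℝ => Complex.exp (t * x * Complex.I)) ν := by
    refine Integrable.of_bound (C := 1) (by fun_prop) (Eventually.of_forall fun x => ?_)
    rw [← Complex.ofReal_mul, Complex.norm_exp_ofReal_mul_I]
  rw [charFun_apply_real, ← RCLike.re_eq_complex_re, ← integral_re hi]
  refine integral_congr_ae (Eventually.of_forall fun x => ?_)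
  simp only [RCLike.re_eq_complex_re]
  rw [← Complex.ofReal_mul, Complex.exp_ofReal_mul_I_re]

/-- The easy half of Bochner's theorem. -/
theorem isCovarianceFunction_re_charFun (ν : Measure ℝ) [IsFiniteMeasure ν] :
    IsCovarianceFunction (fun t => (charFun ν t).re) := by
  refine ⟨Complex.continuous_re.comp continuous_charFun, fun m t => ?_⟩
  refine posSemidef_of_symm_of_sum_nonneg (fun i j => ?_) fun x => ?_
  · simp only [Matrix.of_apply]
    rw [← neg_sub (t i) (t j), charFun_neg, Complex.conj_re]
  · have hi : ∀ i j, Integrable (fun ω => x i * x j * Real.cos ((t i - t j) * ω)) ν := fun i j =>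
      (Integrable.of_bound (C := 1) (by fun_prop)
        (Eventually.of_forall fun ω => by simpa using Real.abs_cos_le_one _)).const_mul _
    simp only [Matrix.of_apply, re_charFun_eq_integral_cos, ← integral_const_mul]
    simp_rw [← integral_finsetSum Finset.univ fun j _ => hi _ j]
    rw [← integral_finsetSum Finset.univ fun i _ => integrable_finsetSum _ fun j _ => hi i j]
    refine integral_nonneg fun ω => ?_
    -- This is the squared modulus of `∑ x i * exp (I * t i * ω)`.
    have : ∑ i, ∑ j, x i * x j * Real.cos ((t i - t j) * ω)
        = (∑ i, x i * Real.cos (t i * ω)) ^ 2 + (∑ i, x i * Real.sin (t i * ω)) ^ 2 := by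
      rw [sq, sq, Finset.sum_mul_sum, Finset.sum_mul_sum, ← Finset.sum_add_distrib]
      refine Finset.sum_congr rfl fun i _ => ?_
      rw [← Finset.sum_add_distrib]
      refine Finset.sum_congr rfl fun j _ => ?_
      rw [sub_mul, Real.cos_sub]
      ring
    simp only [this]
    positivity

theorem integral_indicator_Ico_mul_indicator_Ico (δ a b : ℝ) :
    ∫ s, (Set.Ico a (a + δ)).indicator 1 s * (Set.Ico b (b + δ)).indicator (1 : ℝ → ℝ) s
      = max 0 (δ - |a - b|) := by
  have h : ∀ s, (Set.Ico a (a + δ)).indicator 1 s * (Set.Ico b (b + δ)).indicator (1 : ℝ → ℝ) s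
      = (Set.Ico (max a b) (min a b + δ)).indicator (1 : ℝ → ℝ) s := by
    intro s
    rw [← Pi.mul_apply, ← Set.inter_indicator_one, Set.Ico_inter_Ico, ← min_add_add_right]
  simp_rw [h]
  rw [integral_indicator_one measurableSet_Ico, measureReal_def, Real.volume_Ico,
    ENNReal.toReal_ofReal']
  rw [max_comm]
  congr 1
  rcases le_total a b with hab | hab
  · rw [max_eq_right hab, min_eq_left hab, abs_of_nonpos (by linarith)]; ring
  · rw [max_eq_left hab, min_eq_right hab, abs_of_nonneg (by linarith)]; ring

/-- The triangle is the autocorrelation of the indicator of an interval of length `δ`, so its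
quadratic forms are integrals of squares. -/
theorem isCovarianceFunction_triangle (δ : ℝ) :
    IsCovarianceFunction (fun t => max 0 (δ - |t|)) := by
  refine ⟨by fun_prop, fun m t => ?_⟩
  refine posSemidef_of_symm_of_sum_nonneg (fun i j => ?_) fun x => ?_
  · simp [abs_sub_comm]
  · set e : Fin m → ℝ → ℝ := fun i => (Set.Ico (t i) (t i + δ)).indicator 1
    have hi : ∀ i j, Integrable (fun s => x i * x j * (e i s * e j s)) := by
      intro i j
      refine Integrable.const_mul ?_ _
      have : (fun s => e i s * e j s)
          = (Set.Ico (t i) (t i + δ) ∩ Set.Ico (t j) (t j + δ)).indicator (1 : ℝ → ℝ) := by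
        rw [Set.inter_indicator_one]
        rfl
      rw [this, integrable_indicator_iff (by measurability)]
      refine (integrableOn_const (C := (1 : ℝ)) ?_)
      exact ((measure_mono Set.inter_subset_left).trans_lt measure_Ico_lt_top).ne
    simp only [Matrix.of_apply, ← integral_indicator_Ico_mul_indicator_Ico, ← integral_const_mul]
    change 0 ≤ ∑ i, ∑ j, ∫ s, x i * x j * (e i s * e j s)
    simp_rw [← integral_finsetSum Finset.univ fun j _ => hi _ j]
    rw [← integral_finsetSum Finset.univ fun i _ => integrable_finsetSum _ fun j _ => hi i j]
    refine integral_nonneg fun s => ?_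
    have : ∑ i, ∑ j, x i * x j * (e i s * e j s) = (∑ i, x i * e i s) ^ 2 := by
      rw [sq, Finset.sum_mul_sum]
      exact Finset.sum_congr rfl fun i _ => Finset.sum_congr rfl fun j _ => by ring
    simp only [this]
    positivity

theorem integrable_triangle (δ : ℝ) : Integrable (fun t : ℝ => max 0 (δ - |t|)) := by
  refine Continuous.integrable_of_hasCompactSupport (by fun_prop) ?_
  refine HasCompactSupport.intro (isCompact_Icc (a := -δ) (b := δ)) fun x hx => ?_
  rw [max_eq_left]
  by_contra hc
  exact hx (abs_le.mp (by linarith))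

theorem integral_triangle_le {δ : ℝ} (hδ : 0 ≤ δ) : ∫ t : ℝ, max 0 (δ - |t|) ≤ 2 * δ ^ 2 := by
  have h1 : ∫ t in Set.Icc (-δ) δ, max 0 (δ - |t|) = ∫ t : ℝ, max 0 (δ - |t|) := by
    refine setIntegral_eq_integral_of_forall_compl_eq_zero fun x hx => ?_
    rw [max_eq_left]
    by_contra hc
    exact hx (abs_le.mp (by linarith))
  rw [← h1]
  refine (setIntegral_mono_on (g := fun _ => δ) (integrable_triangle δ).integrableOn
    (integrableOn_const (by simp)) measurableSet_Icc fun x _ => ?_).trans_eq ?_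
  · exact max_le hδ (by linarith [abs_nonneg x])
  · simp [measureReal_def, hδ]
    ring

/-! ### The abstract two-point bound. -/

theorem lintegral_le_sqrt_lintegral_sq {Ω : Type*} [MeasurableSpace Ω] (P : Measure Ω)
    [IsProbabilityMeasure P] {f : Ω → ℝ≥0∞} (hf : Measurable f) :
    ∫⁻ x, f x ∂P ≤ (∫⁻ x, f x ^ 2 ∂P) ^ (1 / 2 : ℝ) := by
  have := ENNReal.lintegral_mul_le_Lp_mul_Lq P Real.HolderConjugate.two_two hf.aemeasurable
    (measurable_const (a := (1 : ℝ≥0∞))).aemeasurable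
  simpa using this

/-- Two-point lower bound for the quadratic risk under a second-moment change of measure. -/
theorem ofReal_abs_sub_le_of_risk_le {Ω : Type*} [MeasurableSpace Ω] {P₀ P₁ : Measure Ω}
    [IsProbabilityMeasure P₀] {B r : ℝ≥0∞} {a₀ a₁ : ℝ} {θ : Ω → ℝ} (hθ : Measurable θ)
    (hB : ∀ f : Ω → ℝ≥0∞, Measurable f →
      ∫⁻ x, f x ∂P₀ ≤ B * (∫⁻ x, f x ^ 2 ∂P₁) ^ (1 / 2 : ℝ))
    (h₀ : (∫⁻ x, ENNReal.ofReal (|θ x - a₀| ^ 2) ∂P₀) ^ (1 / 2 : ℝ) ≤ r)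
    (h₁ : (∫⁻ x, ENNReal.ofReal (|θ x - a₁| ^ 2) ∂P₁) ^ (1 / 2 : ℝ) ≤ r) :
    ENNReal.ofReal |a₀ - a₁| ≤ (1 + B) * r := by
  have hm : ∀ a, Measurable fun x => ENNReal.ofReal |θ x - a| := fun a => by fun_prop
  simp_rw [ENNReal.ofReal_pow (abs_nonneg _)] at h₀ h₁
  calc ENNReal.ofReal |a₀ - a₁|
      = ∫⁻ _, ENNReal.ofReal |a₀ - a₁| ∂P₀ := by simp
    _ ≤ ∫⁻ x, ENNReal.ofReal |θ x - a₀| + ENNReal.ofReal |θ x - a₁| ∂P₀ := by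
        refine lintegral_mono fun x => ?_
        rw [← ENNReal.ofReal_add (abs_nonneg _) (abs_nonneg _)]
        refine ENNReal.ofReal_le_ofReal ?_
        rw [abs_sub_comm (θ x) a₀]
        exact abs_sub_le _ _ _
    _ = ∫⁻ x, ENNReal.ofReal |θ x - a₀| ∂P₀ + ∫⁻ x, ENNReal.ofReal |θ x - a₁| ∂P₀ :=
        lintegral_add_left (hm a₀) _
    _ ≤ r + B * r := by
        gcongr
        · exact (lintegral_le_sqrt_lintegral_sq P₀ (hm a₀)).trans h₀
        · refine (hB _ (hm a₁)).trans ?_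
          gcongr
    _ = (1 + B) * r := by ring

/-! ### The oscillating perturbation: smoothness and slope. -/

theorem iteratedDeriv_re_comp {f : ℝ → ℂ} {k : ℕ} (hf : ContDiff ℝ k f) (t : ℝ) :
    iteratedDeriv k (fun x => (f x).re) t = (iteratedDeriv k f t).re := by
  have := Complex.reCLM.iteratedFDeriv_comp_left (f := f) (x := t) (n := k) hf.contDiffAt
    (i := k) le_rfl
  rw [iteratedDeriv, iteratedDeriv]
  change iteratedFDeriv ℝ k (Complex.reCLM ∘ f) t _ = _
  rw [this]
  rfl

theorem abs_iteratedDeriv_re_charFun_le (ν : Measure ℝ) [IsFiniteMeasure ν] {k : ℕ}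
    (hν : MemLp id k ν) (t : ℝ) :
    |iteratedDeriv k (fun x => (charFun ν x).re) t| ≤ ∫ x, |x| ^ k ∂ν := by
  rw [iteratedDeriv_re_comp (contDiff_charFun hν), iteratedDeriv_charFun hν]
  refine (Complex.abs_re_le_norm _).trans ?_
  rw [norm_mul, norm_pow, Complex.norm_I, one_pow, one_mul]
  refine (norm_integral_le_integral_norm _).trans_eq (integral_congr_ae ?_)
  refine Eventually.of_forall fun x => ?_
  simp only [norm_mul, norm_pow, Complex.norm_real, Real.norm_eq_abs]
  rw [← Complex.ofReal_mul, Complex.norm_exp_ofReal_mul_I, mul_one]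

/-- Interpolation: the increment is at most `2 M A min (1, u)` with `u = a |x - y|`, and `min (1, u)
≤ u ^ s` for `0 < s ≤ 1`. -/
theorem abs_sub_le_rpow_of_deriv_bound {f : ℝ → ℝ} (hf : Differentiable ℝ f) {M a s A : ℝ}
    (ha : 0 ≤ a) (hA : 0 ≤ A) (hM : 0 ≤ M) (hs : 0 < s) (hs1 : s ≤ 1)
    (h₀ : ∀ x, |f x| ≤ M * A) (h₁ : ∀ x, |deriv f x| ≤ M * (A * a)) (x y : ℝ) :
    |f x - f y| ≤ 2 * M * (A * a ^ s) * |x - y| ^ s := by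
  have hd : |f x - f y| ≤ M * (A * a) * |x - y| := by
    have := Convex.norm_image_sub_le_of_norm_deriv_le (s := Set.univ) (f := f) (x := y) (y := x)
      (fun z _ => hf z) (fun z _ => h₁ z) convex_univ (Set.mem_univ _) (Set.mem_univ _)
    simpa using this
  have h2 : |f x - f y| ≤ 2 * M * A := by
    have := abs_sub (f x) (f y)
    linarith [h₀ x, h₀ y]
  have hu : 0 ≤ a * |x - y| := by positivity
  have e : 2 * M * (A * a ^ s) * |x - y| ^ s = 2 * M * A * (a * |x - y|) ^ s := by
    rw [Real.mul_rpow ha (abs_nonneg _)]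
    ring
  have hMA : 0 ≤ M * A := mul_nonneg hM hA
  rw [e]
  rcases le_total 1 (a * |x - y|) with h | h
  · nlinarith [Real.one_le_rpow h hs.le]
  · have : a * |x - y| ≤ (a * |x - y|) ^ s := by
      rcases hu.eq_or_lt with h0 | h0
      · rw [← h0, Real.zero_rpow hs.ne']
      · simpa using Real.rpow_le_rpow_of_exponent_ge h0 h hs1
    nlinarith

/-- The spectral measure obtained by tilting a Gaussian law with the density
`2 (1 - sin (c ω))`. -/
noncomputable def tiltedGaussian (a : ℝ) (V : ℝ≥0) (c : ℝ) : Measure ℝ :=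
  (gaussianReal a V).withDensity fun ω => ENNReal.ofReal (2 * (1 - Real.sin (c * ω)))

theorem tiltedGaussian_le (a : ℝ) (V : ℝ≥0) (c : ℝ) :
    tiltedGaussian a V c ≤ (4 : ℝ≥0∞) • gaussianReal a V := by
  rw [tiltedGaussian, ← withDensity_const]
  refine withDensity_mono (Eventually.of_forall fun ω => ?_)
  have : ENNReal.ofReal (2 * (1 - Real.sin (c * ω))) ≤ ENNReal.ofReal 4 :=
    ENNReal.ofReal_le_ofReal (by linarith [Real.neg_one_le_sin (c * ω)])
  simpa using this

instance isFiniteMeasure_tiltedGaussian (a : ℝ) (V : ℝ≥0) (c : ℝ) :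
    IsFiniteMeasure (tiltedGaussian a V c) := by
  have : IsFiniteMeasure ((4 : ℝ≥0∞) • gaussianReal a V) := Measure.smul_finite _ (by simp)
  exact isFiniteMeasure_of_le _ (tiltedGaussian_le a V c)

theorem memLp_id_tiltedGaussian (a : ℝ) (V : ℝ≥0) (c : ℝ) (k : ℕ) :
    MemLp id k (tiltedGaussian a V c) :=
  (memLp_id_gaussianReal' (k : ℝ≥0∞) (by simp)).of_measure_le_smul (by simp : (4 : ℝ≥0∞) ≠ ∞)
    (tiltedGaussian_le a V c)

theorem integrable_abs_pow_gaussianReal (a : ℝ) (V : ℝ≥0) (k : ℕ) :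
    Integrable (fun x => |x| ^ k) (gaussianReal a V) := by
  have := (memLp_id_gaussianReal' (μ := a) (v := V) (k : ℝ≥0∞) (by simp)).integrable_norm_pow'
  simpa using this

theorem integrable_one_add_abs_pow_gaussianReal (V : ℝ≥0) (k : ℕ) :
    Integrable (fun x => (1 + |x|) ^ k) (gaussianReal 0 V) := by
  simp_rw [add_pow]
  refine integrable_finsetSum _ fun i _ => ?_
  simp only [one_pow, one_mul]
  exact (integrable_abs_pow_gaussianReal 0 V _).mul_const _

/-- After centring, `|x + a| ≤ (1 + |x|) a` because `1 ≤ a`. Moments of the spectral measure control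
derivatives, so each derivative costs one factor `a`. -/
theorem integral_abs_pow_gaussianReal_le {a : ℝ} (ha : 1 ≤ a) (V : ℝ≥0) (k : ℕ) :
    ∫ x, |x| ^ k ∂gaussianReal a V ≤ (∫ x, (1 + |x|) ^ k ∂gaussianReal 0 V) * a ^ k := by
  have h := gaussianReal_map_add_const (μ := 0) (v := V) a
  rw [zero_add] at h
  rw [← h, integral_map (by fun_prop) (by fun_prop), ← integral_mul_const]
  refine integral_mono_of_nonneg (Eventually.of_forall fun x => by positivity)
    ((integrable_one_add_abs_pow_gaussianReal V k).mul_const _) (Eventually.of_forall fun x => ?_)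
  change |x + a| ^ k ≤ (1 + |x|) ^ k * a ^ k
  rw [← mul_pow]
  refine pow_le_pow_left₀ (abs_nonneg _) ?_ k
  have := abs_add_le x a
  rw [abs_of_nonneg (by linarith : 0 ≤ a)] at this
  nlinarith [abs_nonneg x]

theorem integral_abs_pow_tiltedGaussian_le {a : ℝ} (ha : 1 ≤ a) (V : ℝ≥0) (c : ℝ) (k : ℕ) :
    ∫ x, |x| ^ k ∂tiltedGaussian a V c
      ≤ 4 * (∫ x, (1 + |x|) ^ k ∂gaussianReal 0 V) * a ^ k := by
  have h1 : ∫ x, |x| ^ k ∂tiltedGaussian a V c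
      ≤ ∫ x, |x| ^ k ∂((4 : ℝ≥0∞) • gaussianReal a V) := by
    refine integral_mono_measure (tiltedGaussian_le a V c)
      (Eventually.of_forall fun x => by positivity) ?_
    exact (integrable_abs_pow_gaussianReal a V k).smul_measure (by simp)
  refine h1.trans ?_
  rw [integral_smul_measure]
  simp only [ENNReal.toReal_ofNat, smul_eq_mul]
  nlinarith [integral_abs_pow_gaussianReal_le ha V k]

/-- The covariance function with spectral measure `tiltedGaussian a V c`. -/
noncomputable def tiltedCov (a : ℝ) (V : ℝ≥0) (c t : ℝ) : ℝ := (charFun (tiltedGaussian a V c) t).re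

theorem isCovarianceFunction_tiltedCov (a : ℝ) (V : ℝ≥0) (c : ℝ) :
    IsCovarianceFunction (tiltedCov a V c) :=
  isCovarianceFunction_re_charFun _

theorem contDiff_tiltedCov (a : ℝ) (V : ℝ≥0) (c : ℝ) (k : ℕ) : ContDiff ℝ k (tiltedCov a V c) :=
  Complex.reCLM.contDiff.comp (contDiff_charFun (memLp_id_tiltedGaussian a V c k))

theorem abs_iteratedDeriv_tiltedCov_le {a : ℝ} (ha : 1 ≤ a) (V : ℝ≥0) (c : ℝ) (k : ℕ) (t : ℝ) :
    |iteratedDeriv k (tiltedCov a V c) t|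
      ≤ 4 * (∫ x, (1 + |x|) ^ k ∂gaussianReal 0 V) * a ^ k :=
  (abs_iteratedDeriv_re_charFun_le _ (memLp_id_tiltedGaussian a V c k) t).trans
    (integral_abs_pow_tiltedGaussian_le ha V c k)

theorem exists_holder_bound_tiltedCov (V : ℝ≥0) (c : ℝ) (l : ℕ) {s : ℝ} (hs : 0 < s) (hs1 : s ≤ 1) :
    ∃ M, 0 < M ∧ ∀ a, 1 ≤ a → ∀ x y,
      |iteratedDeriv l (tiltedCov a V c) x - iteratedDeriv l (tiltedCov a V c) y|
        ≤ M * a ^ (l + s) * |x - y| ^ s := by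
  set m : ℕ → ℝ := fun k => 4 * ∫ x, (1 + |x|) ^ k ∂gaussianReal 0 V
  have hm : ∀ k, 0 ≤ m k := fun k =>
    mul_nonneg (by norm_num) (integral_nonneg fun x => by positivity)
  refine ⟨2 * (m l + m (l + 1) + 1), by linarith [hm l, hm (l + 1)], fun a ha x y => ?_⟩
  have ha0 : 0 < a := by linarith
  rw [Real.rpow_add ha0, Real.rpow_natCast]
  refine abs_sub_le_rpow_of_deriv_bound (A := a ^ l) (M := m l + m (l + 1) + 1) ?_ ha0.le
    (by positivity) (by linarith [hm l, hm (l + 1)]) hs hs1 (fun x => ?_) (fun x => ?_) x y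
  · exact (contDiff_tiltedCov a V c (l + 1)).differentiable_iteratedDeriv l (by norm_cast; omega)
  · refine (abs_iteratedDeriv_tiltedCov_le ha V c l x).trans ?_
    gcongr
    linarith [hm l, hm (l + 1)]
  · rw [← iteratedDeriv_succ, ← pow_succ]
    refine (abs_iteratedDeriv_tiltedCov_le ha V c (l + 1) x).trans ?_
    gcongr
    linarith [hm l, hm (l + 1)]

theorem re_charFun_gaussianReal (a : ℝ) (V : ℝ≥0) (t : ℝ) :
    (charFun (gaussianReal a V) t).re = Real.exp (-(V * t ^ 2 / 2)) * Real.cos (a * t) := by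
  rw [charFun_gaussianReal]
  have : (t * a * Complex.I - V * t ^ 2 / 2 : ℂ)
      = ((-(V * t ^ 2 / 2) : ℝ) : ℂ) + ((a * t : ℝ) : ℂ) * Complex.I := by
    push_cast
    ring
  rw [this, Complex.exp_add, ← Complex.ofReal_exp, Complex.re_ofReal_mul,
    Complex.exp_ofReal_mul_I_re]

theorem im_charFun_gaussianReal (a : ℝ) (V : ℝ≥0) (t : ℝ) :
    (charFun (gaussianReal a V) t).im = Real.exp (-(V * t ^ 2 / 2)) * Real.sin (a * t) := by
  rw [charFun_gaussianReal]
  have : (t * a * Complex.I - V * t ^ 2 / 2 : ℂ)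
      = ((-(V * t ^ 2 / 2) : ℝ) : ℂ) + ((a * t : ℝ) : ℂ) * Complex.I := by
    push_cast
    ring
  rw [this, Complex.exp_add, ← Complex.ofReal_exp, Complex.im_ofReal_mul,
    Complex.exp_ofReal_mul_I_im]

theorem im_charFun_eq_integral_sin (ν : Measure ℝ) [IsFiniteMeasure ν] (t : ℝ) :
    (charFun ν t).im = ∫ x, Real.sin (t * x) ∂ν := by
  have hi : Integrable (fun x : ℝ => Complex.exp (t * x * Complex.I)) ν := by
    refine Integrable.of_bound (C := 1) (by fun_prop) (Eventually.of_forall fun x => ?_)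
    rw [← Complex.ofReal_mul, Complex.norm_exp_ofReal_mul_I]
  rw [charFun_apply_real, ← RCLike.im_eq_complex_im, ← integral_im hi]
  refine integral_congr_ae (Eventually.of_forall fun x => ?_)
  simp only [RCLike.im_eq_complex_im]
  rw [← Complex.ofReal_mul, Complex.exp_ofReal_mul_I_im]

/-- The product formula for `2 cos (t ω) sin (c ω)` splits the tilt into sine packets at `±c`. The
constant part of the density keeps it nonnegative, at the price of a cosine packet at the origin. -/
theorem tiltedCov_eq (a : ℝ) (V : ℝ≥0) (c t : ℝ) :
    tiltedCov a V c t = 2 * (Real.exp (-(V * t ^ 2 / 2)) * Real.cos (a * t))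
      + Real.exp (-(V * (t - c) ^ 2 / 2)) * Real.sin (a * (t - c))
      - Real.exp (-(V * (t + c) ^ 2 / 2)) * Real.sin (a * (t + c)) := by
  have hc : ∀ u : ℝ, Integrable (fun x => Real.cos (u * x)) (gaussianReal a V) := fun u =>
    Integrable.of_bound (C := 1) (by fun_prop)
      (Eventually.of_forall fun ω => by simpa using Real.abs_cos_le_one _)
  have hs : ∀ u : ℝ, Integrable (fun x => Real.sin (u * x)) (gaussianReal a V) := fun u =>
    Integrable.of_bound (C := 1) (by fun_prop)
      (Eventually.of_forall fun ω => by simpa using Real.abs_sin_le_one _)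
  rw [tiltedCov, re_charFun_eq_integral_cos, ← re_charFun_gaussianReal, ← im_charFun_gaussianReal,
    ← im_charFun_gaussianReal, re_charFun_eq_integral_cos, im_charFun_eq_integral_sin,
    im_charFun_eq_integral_sin, tiltedGaussian,
    integral_withDensity_eq_integral_toReal_smul (by fun_prop)
      (Eventually.of_forall fun _ => ENNReal.ofReal_lt_top),
    ← integral_const_mul, ← integral_add ((hc t).const_mul 2) (hs _),
    ← integral_sub (f := fun x => 2 * Real.cos (t * x) + Real.sin ((t - c) * x))
      (((hc t).const_mul 2).add (hs _)) (hs _)]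
  refine integral_congr_ae (Eventually.of_forall fun x => ?_)
  simp only [smul_eq_mul]
  rw [ENNReal.toReal_ofReal (by linarith [Real.sin_le_one (c * x)]), sub_mul, add_mul,
    Real.sin_sub, Real.sin_add]
  ring

theorem hasDerivAt_exp_neg_sq (V t : ℝ) :
    HasDerivAt (fun t : ℝ => Real.exp (-(V * t ^ 2 / 2)))
      (-(V * t) * Real.exp (-(V * t ^ 2 / 2))) t := by
  have h : HasDerivAt (fun t : ℝ => -(V * t ^ 2 / 2)) (-(V * t)) t := by
    refine (((hasDerivAt_pow 2 t).const_mul V).div_const 2).neg.congr_deriv ?_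
    push_cast
    ring
  exact h.exp.congr_deriv (by ring)

/-- The packet centred at `c` contributes exactly `a`. The packets at `0` and `-c` are damped by
`hV`, and `V * c ≤ a` bounds the derivatives of their envelopes; together they cost at most `6 a /
16`. -/
theorem half_le_deriv_tiltedCov {a : ℝ} {V : ℝ≥0} {c : ℝ} (hc : 0 ≤ c) (ha : V * c ≤ a)
    (hV : Real.exp (-(V * c ^ 2 / 2)) ≤ 1 / 16) : a / 2 ≤ deriv (tiltedCov a V c) c := by
  have hVn : (0 : ℝ) ≤ V := V.2
  have ha0 : 0 ≤ a := (mul_nonneg hVn hc).trans ha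
  have hlin : ∀ u, HasDerivAt (fun t : ℝ => a * t) a u := fun u => by
    simpa using (hasDerivAt_id u).const_mul a
  have hC := fun u => (hasDerivAt_exp_neg_sq V u).mul (hlin u).cos
  have hS := fun u => (hasDerivAt_exp_neg_sq V u).mul (hlin u).sin
  have h1 := (((hC c).const_mul 2).add ((hS (c - c)).comp_sub_const c c)).sub
    ((hS (c + c)).comp_add_const c c)
  have hfun : tiltedCov a V c = _ := funext (tiltedCov_eq a V c)
  rw [hfun]
  refine le_of_le_of_eq ?_ h1.deriv.symm
  have hp4 : Real.exp (-(V * (c + c) ^ 2 / 2)) ≤ 1 / 16 := by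
    refine (Real.exp_le_exp.mpr ?_).trans hV
    nlinarith [mul_nonneg hVn (sq_nonneg c)]
  set p := Real.exp (-(V * c ^ 2 / 2))
  set p4 := Real.exp (-(V * (c + c) ^ 2 / 2))
  have hp0 : 0 < p := Real.exp_pos _
  have hp40 : 0 < p4 := Real.exp_pos _
  simp only [sub_self, ne_eq, OfNat.ofNat_ne_zero, not_false_eq_true, zero_pow, mul_zero, zero_div,
    neg_zero, Real.exp_zero, Real.cos_zero, Real.sin_zero]
  have hVc : 0 ≤ V * c := mul_nonneg hVn hc
  have b1 : V * c * p * Real.cos (a * c) ≤ a * (1 / 16) := by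
    nlinarith [mul_le_mul_of_nonneg_left (Real.cos_le_one (a * c)) (mul_nonneg hVc hp0.le),
      mul_le_mul ha hV hp0.le ha0]
  have b2 : p * (a * Real.sin (a * c)) ≤ a * (1 / 16) := by
    nlinarith [mul_le_mul_of_nonneg_left (Real.sin_le_one (a * c)) (mul_nonneg ha0 hp0.le),
      mul_le_mul_of_nonneg_left hV ha0]
  have b3 : -(V * c * p4 * Real.sin (a * (c + c))) ≤ a * (1 / 16) := by
    nlinarith [mul_le_mul_of_nonneg_left (Real.neg_one_le_sin (a * (c + c)))
      (mul_nonneg hVc hp40.le), mul_le_mul ha hp4 hp40.le ha0]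
  have b4 : p4 * (a * Real.cos (a * (c + c))) ≤ a * (1 / 16) := by
    nlinarith [mul_le_mul_of_nonneg_left (Real.cos_le_one (a * (c + c))) (mul_nonneg ha0 hp40.le),
      mul_le_mul_of_nonneg_left hp4 ha0]
  nlinarith

/-! ### Size of the perturbation, uniformly in the frequency `a`. -/

/-- The sum of Gaussian bumps dominating `|tiltedCov a V c|`. -/
noncomputable def bumpEnvelope (V : ℝ≥0) (c t : ℝ) : ℝ :=
  2 * Real.exp (-(V * t ^ 2 / 2)) + Real.exp (-(V * (t - c) ^ 2 / 2))
    + Real.exp (-(V * (t + c) ^ 2 / 2))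

theorem abs_tiltedCov_le (a : ℝ) (V : ℝ≥0) (c t : ℝ) :
    |tiltedCov a V c t| ≤ bumpEnvelope V c t := by
  rw [tiltedCov_eq, bumpEnvelope]
  have h : ∀ u w : ℝ, |w| ≤ 1 → |Real.exp u * w| ≤ Real.exp u := fun u w hw => by
    rw [abs_mul, abs_of_pos (Real.exp_pos u)]
    exact mul_le_of_le_one_right (Real.exp_pos u).le hw
  have h1 := abs_le.mp (h (-(V * t ^ 2 / 2)) _ (Real.abs_cos_le_one (a * t)))
  have h2 := abs_le.mp (h (-(V * (t - c) ^ 2 / 2)) _ (Real.abs_sin_le_one (a * (t - c))))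
  have h3 := abs_le.mp (h (-(V * (t + c) ^ 2 / 2)) _ (Real.abs_sin_le_one (a * (t + c))))
  rw [abs_le]
  constructor <;> linarith [h1.1, h1.2, h2.1, h2.2, h3.1, h3.2]

theorem bumpEnvelope_le_four (V : ℝ≥0) (c t : ℝ) : bumpEnvelope V c t ≤ 4 := by
  have h : ∀ u : ℝ, Real.exp (-(V * u ^ 2 / 2)) ≤ 1 := fun u =>
    Real.exp_le_one_iff.mpr (by have := V.2; simp; positivity)
  rw [bumpEnvelope]
  linarith [h t, h (t - c), h (t + c)]

theorem integrable_exp_neg_mul_sq_div {V : ℝ} (hV : 0 < V) :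
    Integrable (fun t : ℝ => Real.exp (-(V * t ^ 2 / 2))) := by
  convert integrable_exp_neg_mul_sq (half_pos hV) using 3
  ring

theorem integrable_bumpEnvelope {V : ℝ≥0} (hV : 0 < V) (c : ℝ) :
    Integrable (bumpEnvelope V c) := by
  have h := integrable_exp_neg_mul_sq_div (V := V) hV
  exact ((h.const_mul 2).add (h.comp_sub_right c)).add (h.comp_add_right c)

/-- A Riemann sum compared cell by cell with a Gaussian integral. Halving `V` and paying `exp V`
absorbs the variation over a cell of length at most `1`. -/
theorem mul_sum_exp_neg_sq_le {V : ℝ} (hV : 0 < V) {δ : ℝ} (hδ : 0 ≤ δ) (hδ1 : δ ≤ 1) (n : ℕ)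
    (c : ℝ) : δ * ∑ j ∈ Finset.range n, Real.exp (-(V * (j * δ - c) ^ 2 / 2))
      ≤ Real.exp V * ∫ t : ℝ, Real.exp (-(V / 2 * t ^ 2 / 2)) := by
  have hi := integrable_exp_neg_mul_sq_div (half_pos hV)
  rw [Finset.mul_sum, ← integral_const_mul]
  have step : ∀ j ∈ Finset.range n, δ * Real.exp (-(V * (j * δ - c) ^ 2 / 2))
      ≤ ∫ t in ((j : ℕ) * δ - c)..((j + 1 : ℕ) * δ - c),
        Real.exp V * Real.exp (-(V / 2 * t ^ 2 / 2)) := by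
    intro j _
    have hab : (j : ℝ) * δ - c ≤ ((j + 1 : ℕ) : ℝ) * δ - c := by push_cast; nlinarith
    have e : δ * Real.exp (-(V * (j * δ - c) ^ 2 / 2))
        = ∫ t in ((j : ℕ) * δ - c)..((j + 1 : ℕ) * δ - c),
          Real.exp (-(V * (j * δ - c) ^ 2 / 2)) := by
      rw [intervalIntegral.integral_const, smul_eq_mul]
      push_cast
      ring
    rw [e]
    refine intervalIntegral.integral_mono_on hab (by simp)
      (hi.const_mul _).intervalIntegrable fun t ht => ?_
    rw [← Real.exp_add]
    refine Real.exp_le_exp.mpr ?_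
    have h1 : 0 ≤ t - (j * δ - c) := by linarith [ht.1]
    have h2 : t - (j * δ - c) ≤ 1 := by
      have := ht.2
      push_cast at this
      linarith
    set u := (j : ℝ) * δ - c
    have h3 : t ^ 2 ≤ 2 * u ^ 2 + 2 := by nlinarith [sq_nonneg (u - (t - u))]
    nlinarith
  refine (Finset.sum_le_sum step).trans ?_
  rw [intervalIntegral.sum_integral_adjacent_intervals
    (a := fun j : ℕ => (j : ℝ) * δ - c) fun j _ => (hi.const_mul _).intervalIntegrable,
    intervalIntegral.integral_of_le (by simp; positivity)]
  exact setIntegral_le_integral (hi.const_mul _) (Eventually.of_forall fun t => by positivity)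

theorem exists_sum_sq_tiltedCov_le {V : ℝ≥0} (hV : 0 < V) (c : ℝ) :
    ∃ C, 0 < C ∧ ∀ (a δ : ℝ) (n : ℕ), 0 < δ → δ ≤ 1 →
      ∑ i : Fin n, ∑ j : Fin n, tiltedCov a V c (gridPoint n δ i - gridPoint n δ j) ^ 2
        ≤ n * (C / δ) := by
  have hV' : (0 : ℝ) < V := hV
  set H := Real.exp V * ∫ t : ℝ, Real.exp (-((V : ℝ) / 2 * t ^ 2 / 2)) with hH
  have hH0 : 0 ≤ H := mul_nonneg (Real.exp_pos _).le (integral_nonneg fun t => (Real.exp_pos _).le)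
  refine ⟨16 * H + 1, by positivity, fun a δ n hδ hδ1 => ?_⟩
  have key : ∀ i : Fin n,
      ∑ j : Fin n, tiltedCov a V c (gridPoint n δ i - gridPoint n δ j) ^ 2
        ≤ (16 * H + 1) / δ := by
    intro i
    rw [le_div_iff₀ hδ]
    have hb : ∀ u : ℝ, δ * ∑ j : Fin n, Real.exp (-((V : ℝ) * ((j : ℕ) * δ - u) ^ 2 / 2)) ≤ H := by
      intro u
      have := mul_sum_exp_neg_sq_le hV' hδ.le hδ1 n u
      rwa [← Fin.sum_univ_eq_sum_range
        (fun j => Real.exp (-((V : ℝ) * ((j : ℕ) * δ - u) ^ 2 / 2)))] at this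
    -- One factor of the square is bounded by `4`, the other by the envelope, which is summable
    -- along a row.
    have hle : ∀ j : Fin n, tiltedCov a V c (gridPoint n δ i - gridPoint n δ j) ^ 2
        ≤ 4 * (2 * Real.exp (-((V : ℝ) * ((j : ℕ) * δ - (i : ℕ) * δ) ^ 2 / 2))
          + Real.exp (-((V : ℝ) * ((j : ℕ) * δ - ((i : ℕ) * δ - c)) ^ 2 / 2))
          + Real.exp (-((V : ℝ) * ((j : ℕ) * δ - ((i : ℕ) * δ + c)) ^ 2 / 2))) := by
      intro j
      have h1 := abs_tiltedCov_le a V c (gridPoint n δ i - gridPoint n δ j)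
      have h2 := bumpEnvelope_le_four V c (gridPoint n δ i - gridPoint n δ j)
      have h3 := abs_nonneg (tiltedCov a V c (gridPoint n δ i - gridPoint n δ j))
      have e : bumpEnvelope V c (gridPoint n δ i - gridPoint n δ j)
          = 2 * Real.exp (-((V : ℝ) * ((j : ℕ) * δ - (i : ℕ) * δ) ^ 2 / 2))
          + Real.exp (-((V : ℝ) * ((j : ℕ) * δ - ((i : ℕ) * δ - c)) ^ 2 / 2))
          + Real.exp (-((V : ℝ) * ((j : ℕ) * δ - ((i : ℕ) * δ + c)) ^ 2 / 2)) := by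
        rw [bumpEnvelope, gridPoint, gridPoint]
        congr 1
        · congr 1
          · congr 3
            ring
          · congr 3
            ring
        · congr 3
          ring
      rw [← e, ← sq_abs]
      nlinarith
    refine (mul_le_mul_of_nonneg_right (Finset.sum_le_sum fun j _ => hle j) hδ.le).trans ?_
    rw [← Finset.mul_sum, Finset.sum_add_distrib, Finset.sum_add_distrib, ← Finset.mul_sum]
    linarith [hb ((i : ℕ) * δ), hb ((i : ℕ) * δ - c), hb ((i : ℕ) * δ + c)]
  refine (Finset.sum_le_sum fun i _ => key i).trans_eq ?_
  simp

/-! ### The null covariance. -/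

/-- A triangular covariance function which is white noise on the grid of mesh `δ`. -/
noncomputable def triangleCov (K δ t : ℝ) : ℝ := K / (4 * δ ^ 2) * max 0 (δ - |t|)

theorem isCovarianceFunction_triangleCov {K : ℝ} (hK : 0 ≤ K) (δ : ℝ) :
    IsCovarianceFunction (triangleCov K δ) :=
  (isCovarianceFunction_triangle δ).const_mul (by positivity)

theorem triangleCov_eq_zero {K δ t : ℝ} (h : δ ≤ |t|) : triangleCov K δ t = 0 := by
  rw [triangleCov, max_eq_left (by linarith), mul_zero]

theorem integrable_triangleCov (K δ : ℝ) : Integrable (triangleCov K δ) :=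
  (integrable_triangle δ).const_mul _

theorem integral_abs_triangleCov_le {K δ : ℝ} (hK : 0 ≤ K) (hδ : 0 < δ) :
    ∫ t, |triangleCov K δ t| ≤ K / 2 := by
  have h : ∀ t, |triangleCov K δ t| = K / (4 * δ ^ 2) * max 0 (δ - |t|) := fun t =>
    abs_of_nonneg (mul_nonneg (by positivity) (le_max_left _ _))
  simp_rw [h]
  rw [integral_const_mul]
  refine (mul_le_mul_of_nonneg_left (integral_triangle_le hδ.le) (by positivity)).trans_eq ?_
  field_simp
  norm_num

theorem triangleCov_gridPoint {K δ : ℝ} (hδ : 0 < δ) (n : ℕ) :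
    (Matrix.of fun i j => triangleCov K δ (gridPoint n δ i - gridPoint n δ j))
      = (K / (4 * δ)) • (1 : Matrix (Fin n) (Fin n) ℝ) := by
  ext i j
  rw [Matrix.of_apply, Matrix.smul_apply, Matrix.one_apply]
  split_ifs with hij
  · subst hij
    rw [sub_self, triangleCov, abs_zero, sub_zero, max_eq_right hδ.le]
    simp only [smul_eq_mul, mul_one]
    field_simp
  · rw [smul_zero]
    refine triangleCov_eq_zero ?_
    have h1 : gridPoint n δ i - gridPoint n δ j = (((i : ℕ) : ℤ) - ((j : ℕ) : ℤ) : ℤ) * δ := by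
      simp only [gridPoint]
      push_cast
      ring
    have h2 : (((i : ℕ) : ℤ) - ((j : ℕ) : ℤ) : ℤ) ≠ 0 := by
      intro h
      exact hij (Fin.ext (by omega))
    have h3 : (1 : ℝ) ≤ |((((i : ℕ) : ℤ) - ((j : ℕ) : ℤ) : ℤ) : ℝ)| := by
      exact_mod_cast Int.one_le_abs h2
    rw [h1, abs_mul, abs_of_pos hδ]
    nlinarith

/-! ### The minimax lower bound. -/

theorem smoothnessOrder_exponent {β : ℝ} (hβ : 0 < β) :
    0 < β + 1 - (smoothnessOrder β : ℝ) ∧ β + 1 - (smoothnessOrder β : ℝ) ≤ 1 := by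
  have h1 := Nat.ceil_lt_add_one hβ.le
  have h2 := Nat.le_ceil β
  rw [smoothnessOrder]
  constructor <;> linarith

/-- A covariance function coinciding on `I` with a smooth one belongs to the class as soon as the
smooth one satisfies the Hölder bound. -/
theorem mem_covClass_of_eqOn {β L x₀ d K : ℝ} (hd : 0 < d) {γ g : ℝ → ℝ}
    (hγ : IsCovarianceFunction γ) (hi : Integrable γ) (hK : ∫ t, |γ t| ≤ K)
    (hg : ContDiff ℝ (smoothnessOrder β) g) (heq : Set.EqOn γ g (Set.Icc (x₀ - d) (x₀ + d)))
    (hL : ∀ x y, |iteratedDeriv (smoothnessOrder β) g x - iteratedDeriv (smoothnessOrder β) g y|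
      ≤ L * |x - y| ^ (β + 1 - (smoothnessOrder β : ℝ))) :
    γ ∈ covClass β L x₀ d K := by
  have hU : UniqueDiffOn ℝ (Set.Icc (x₀ - d) (x₀ + d)) := uniqueDiffOn_Icc (by linarith)
  have hw : ∀ x ∈ Set.Icc (x₀ - d) (x₀ + d),
      iteratedDerivWithin (smoothnessOrder β) γ (Set.Icc (x₀ - d) (x₀ + d)) x
        = iteratedDeriv (smoothnessOrder β) g x := fun x hx =>
    (iteratedDerivWithin_congr heq hx).trans
      (iteratedDerivWithin_eq_iteratedDeriv hU hg.contDiffAt hx)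
  refine ⟨hγ, hi, hK, hg.contDiffOn.congr heq, fun x hx y hy => ?_⟩
  rw [hw x hx, hw y hy]
  exact hL x y

theorem derivMinimaxRisk_two_point {n : ℕ} {δ x₀ : ℝ} {C : Set (ℝ → ℝ)} {γ₀ γ₁ : ℝ → ℝ}
    (h₀ : γ₀ ∈ C) (h₁ : γ₁ ∈ C) {B : ℝ≥0∞}
    (hB : ∀ f : EuclideanSpace ℝ (Fin n) → ℝ≥0∞, Measurable f →
      ∫⁻ x, f x ∂sampleLaw n δ γ₀ ≤ B * (∫⁻ x, f x ^ 2 ∂sampleLaw n δ γ₁) ^ (1 / 2 : ℝ)) :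
    ENNReal.ofReal |deriv γ₀ x₀ - deriv γ₁ x₀| / (1 + B) ≤ derivMinimaxRisk n δ x₀ C := by
  refine le_iInf₂ fun θ hθ => ?_
  refine ENNReal.div_le_of_le_mul' ?_
  have : IsProbabilityMeasure (sampleLaw n δ γ₀) := by rw [sampleLaw]; infer_instance
  exact ofReal_abs_sub_le_of_risk_le hθ hB
    (le_iSup₂ (f := fun γ (_ : γ ∈ C) =>
      (∫⁻ x, ENNReal.ofReal (|θ x - deriv γ x₀| ^ 2) ∂sampleLaw n δ γ) ^ (1 / 2 : ℝ)) γ₀ h₀)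
    (le_iSup₂ (f := fun γ (_ : γ ∈ C) =>
      (∫⁻ x, ENNReal.ofReal (|θ x - deriv γ x₀| ^ 2) ∂sampleLaw n δ γ) ^ (1 / 2 : ℝ)) γ₁ h₁)

/-- Non-asymptotic form with amplitude `ε` and frequency `a` left free: `J` limits the `L¹` budget,
`M` the Hölder budget, and `C` measures the information carried by the sample. -/
theorem exists_derivMinimaxRisk_lower_bound (β x₀ d K : ℝ) (hβ : 0 < β) (hd : 0 < d)
    (hdx : d < x₀) (hK : 0 < K) :
    ∃ M J C a₀ : ℝ, 0 < M ∧ 0 < J ∧ 0 < C ∧ ∀ (L δ ε a : ℝ) (n : ℕ),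
      0 < δ → δ ≤ 1 → δ < x₀ - d → 0 < ε → ε * J ≤ K → a₀ ≤ a → ε * (M * a ^ (β + 1)) ≤ L →
      ENNReal.ofReal (ε * (a / 2)) / (1 + ENNReal.ofReal (Real.exp (C * (ε ^ 2 * (n * δ)))))
        ≤ derivMinimaxRisk n δ x₀ (covClass β L x₀ d K) := by
  have hx₀ : 0 < x₀ := hd.trans hdx
  -- Chosen so that `V * x₀ ^ 2 / 2 = 4`, and `exp (-4) ≤ 2⁻⁴`.
  obtain ⟨V, hV⟩ : ∃ V : ℝ≥0, (V : ℝ) = 8 / x₀ ^ 2 := ⟨⟨8 / x₀ ^ 2, by positivity⟩, rfl⟩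
  have hV0 : 0 < V := by
    rw [← NNReal.coe_pos, hV]
    positivity
  have hVexp : Real.exp (-(V * x₀ ^ 2 / 2)) ≤ 1 / 16 := by
    have e : -((V : ℝ) * x₀ ^ 2 / 2) = -((4 : ℕ) * 1) := by
      rw [hV]
      field_simp
      norm_num
    rw [e, Real.exp_neg, Real.exp_nat_mul, one_div]
    refine inv_anti₀ (by norm_num) ?_
    have : (2 : ℝ) ≤ Real.exp 1 := by linarith [Real.add_one_le_exp (1 : ℝ)]
    calc (16 : ℝ) = 2 ^ 4 := by norm_num
      _ ≤ _ := pow_le_pow_left₀ (by norm_num) this 4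
  obtain ⟨hs, hs1⟩ := smoothnessOrder_exponent hβ
  obtain ⟨M, hM, hhold⟩ := exists_holder_bound_tiltedCov V x₀ (smoothnessOrder β) hs hs1
  obtain ⟨C, hC, hsum⟩ := exists_sum_sq_tiltedCov_le hV0 x₀
  set J := ∫ t, bumpEnvelope V x₀ t
  have hJ : 0 ≤ J := integral_nonneg fun t => by
    simp only [bumpEnvelope, Pi.zero_apply]
    positivity
  -- The factor in `2 * J` leaves half of `K` to the triangle; `8 * C / K ^ 2` is half of `C / δ`
  -- over `(K / (4δ)) ^ 2`, divided by `δ`.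
  refine ⟨M, 2 * J + 1, 8 * C / K ^ 2, max 1 (V * x₀), hM, by linarith, by positivity,
    fun L δ ε a n hδ hδ1 hδd hε hεJ ha hL => ?_⟩
  have ha1 : 1 ≤ a := (le_max_left _ _).trans ha
  have haV : V * x₀ ≤ a := (le_max_right _ _).trans ha
  set q := tiltedCov a V x₀
  have hqcov : IsCovarianceFunction (fun t => ε * q t) :=
    (isCovarianceFunction_tiltedCov a V x₀).const_mul hε.le
  have hqi : Integrable q := (integrable_bumpEnvelope hV0 x₀).mono'
    (isCovarianceFunction_tiltedCov a V x₀).1.aestronglyMeasurable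
    (Eventually.of_forall fun t => abs_tiltedCov_le a V x₀ t)
  have hqJ : ∫ t, |ε * q t| ≤ K / 2 := by
    have h1 : ∫ t, |q t| ≤ J := integral_mono hqi.abs (integrable_bumpEnvelope hV0 x₀)
      fun t => abs_tiltedCov_le a V x₀ t
    simp_rw [abs_mul, abs_of_pos hε]
    rw [integral_const_mul]
    nlinarith
  have hL0 : 0 ≤ L := le_trans (by positivity) hL
  have hcov₀ := isCovarianceFunction_triangleCov hK.le δ
  have hI : ∀ x ∈ Set.Icc (x₀ - d) (x₀ + d), triangleCov K δ x = 0 := fun x hx =>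
    triangleCov_eq_zero ((hδd.le.trans hx.1).trans (le_abs_self x))
  have hev : ∀ᶠ x in 𝓝 x₀, triangleCov K δ x = 0 :=
    eventually_of_mem (Icc_mem_nhds (by linarith) (by linarith)) hI
  have hmem₀ : triangleCov K δ ∈ covClass β L x₀ d K := by
    refine mem_covClass_of_eqOn hd (g := fun _ => 0) hcov₀ (integrable_triangleCov K δ)
      ((integral_abs_triangleCov_le hK.le hδ).trans (by linarith)) contDiff_const hI fun x y => ?_
    simp only [iteratedDeriv_const, ite_self, sub_self, abs_zero]
    positivity
  have hmem₁ : (fun t => triangleCov K δ t + ε * q t) ∈ covClass β L x₀ d K := by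
    refine mem_covClass_of_eqOn hd (g := fun t => ε * q t) (hcov₀.add hqcov)
      ((integrable_triangleCov K δ).add (hqi.const_mul ε)) ?_
      ((contDiff_tiltedCov a V x₀ _).const_smul ε) (fun x hx => by simp [hI x hx]) fun x y => ?_
    · calc ∫ t, |triangleCov K δ t + ε * q t|
          ≤ ∫ t, (|triangleCov K δ t| + |ε * q t|) :=
            integral_mono ((integrable_triangleCov K δ).add (hqi.const_mul ε)).abs
              ((integrable_triangleCov K δ).abs.add (hqi.const_mul ε).abs)
              fun t => abs_add_le _ _
        _ = (∫ t, |triangleCov K δ t|) + ∫ t, |ε * q t| :=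
            integral_add (integrable_triangleCov K δ).abs (hqi.const_mul ε).abs
        _ ≤ K := by linarith [integral_abs_triangleCov_le hK.le hδ]
    · have hx : ∀ x, iteratedDeriv (smoothnessOrder β) (fun t => ε * q t) x
          = ε * iteratedDeriv (smoothnessOrder β) q x := fun x =>
        iteratedDeriv_const_mul_field ε q
      have hb := hhold a ha1 x y
      rw [add_sub_cancel] at hb
      rw [hx, hx, ← mul_sub, abs_mul, abs_of_pos hε]
      calc ε * |iteratedDeriv (smoothnessOrder β) q x - iteratedDeriv (smoothnessOrder β) q y|
          ≤ ε * (M * a ^ (β + 1) * |x - y| ^ (β + 1 - (smoothnessOrder β : ℝ))) := by gcongr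
        _ = ε * (M * a ^ (β + 1)) * |x - y| ^ (β + 1 - (smoothnessOrder β : ℝ)) := by ring
        _ ≤ _ := by gcongr
  have hd₀ : deriv (triangleCov K δ) x₀ = 0 := by
    have : triangleCov K δ =ᶠ[𝓝 x₀] fun _ => 0 := hev
    rw [this.deriv_eq]
    simp
  have hd₁ : ε * (a / 2) ≤ deriv (fun t => triangleCov K δ t + ε * q t) x₀ := by
    have : (fun t => triangleCov K δ t + ε * q t) =ᶠ[𝓝 x₀] fun t => ε * q t := by
      filter_upwards [hev] with t ht
      rw [ht, zero_add]
    rw [this.deriv_eq, deriv_const_mul_field]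
    exact mul_le_mul_of_nonneg_left (half_le_deriv_tiltedCov hx₀.le haV hVexp) hε.le
  set D : Matrix (Fin n) (Fin n) ℝ :=
    Matrix.of fun i j => ε * q (gridPoint n δ i - gridPoint n δ j) with hD
  have hDpsd : D.PosSemidef := hqcov.2 n _
  have hv : 0 < K / (4 * δ) := by positivity
  have hlaw₀ : sampleLaw n δ (triangleCov K δ)
      = multivariateGaussian 0 ((K / (4 * δ)) • (1 : Matrix (Fin n) (Fin n) ℝ)) := by
    rw [sampleLaw, triangleCov_gridPoint hδ]
  have hlaw₁ : sampleLaw n δ (fun t => triangleCov K δ t + ε * q t)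
      = multivariateGaussian 0 ((K / (4 * δ)) • (1 : Matrix (Fin n) (Fin n) ℝ) + D) := by
    rw [sampleLaw, ← triangleCov_gridPoint hδ]
    rfl
  have hfrob : (∑ i, ∑ j, D i j ^ 2) / (K / (4 * δ)) ^ 2 / 2
      ≤ 8 * C / K ^ 2 * (ε ^ 2 * (n * δ)) := by
    have h1 : ∑ i, ∑ j, D i j ^ 2 ≤ ε ^ 2 * (n * (C / δ)) := by
      simp only [hD, Matrix.of_apply, mul_pow, ← Finset.mul_sum]
      exact mul_le_mul_of_nonneg_left (hsum a δ n hδ hδ1) (sq_nonneg ε)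
    calc (∑ i, ∑ j, D i j ^ 2) / (K / (4 * δ)) ^ 2 / 2
        ≤ ε ^ 2 * (n * (C / δ)) / (K / (4 * δ)) ^ 2 / 2 := by gcongr
      _ = 8 * C / K ^ 2 * (ε ^ 2 * (n * δ)) := by
          field_simp
          ring
  refine le_trans ?_ (derivMinimaxRisk_two_point hmem₀ hmem₁
    (B := ENNReal.ofReal (Real.exp (8 * C / K ^ 2 * (ε ^ 2 * (n * δ))))) fun f hf => ?_)
  · gcongr
    rw [hd₀, zero_sub, abs_neg]
    exact hd₁.trans (le_abs_self _)
  · rw [hlaw₀, hlaw₁]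
    refine (lintegral_multivariateGaussian_smul_one_le hDpsd hv hf).trans ?_
    gcongr
    rw [ENNReal.ofReal_rpow_of_pos (Real.exp_pos _), ← Real.exp_mul]
    refine ENNReal.ofReal_le_ofReal (Real.exp_le_exp.mpr ?_)
    have : 0 ≤ (∑ i, ∑ j, D i j ^ 2) / (K / (4 * δ)) ^ 2 / 2 := by positivity
    linarith

theorem theorem4 (β x₀ d K : ℝ) (hβ : 0 < β) (hd : 0 < d) (hdx : d < x₀) (hK : 0 < K) :
    ∃ C₁ C₂ c : ℝ, 0 < C₁ ∧ 0 < C₂ ∧ 0 < c ∧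
      ∀ L : ℝ, 0 < L → ∀ (n : ℕ → ℕ) (δ T : ℕ → ℝ),
        (∀ k, 0 < δ k) → (∀ k, T k = (n k : ℝ) * δ k) → Tendsto T atTop atTop →
        (∀ᶠ k in atTop, C₁ * (δ k) ^ (-2 : ℝ) ≤ T k ∧
          L ^ 2 * T k ≤ C₂ * (δ k) ^ (-2 * β - 2)) →
        ENNReal.ofReal c ≤ liminf (fun k =>
          ENNReal.ofReal (L ^ (-(1 / (β + 1))) * (T k) ^ (β / (2 * β + 2))) *
            derivMinimaxRisk (n k) (δ k) x₀ (covClass β L x₀ d K)) atTop := by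
  obtain ⟨M, J, C, a₀, hM, hJ, hC, hlow⟩ :=
    exists_derivMinimaxRisk_lower_bound β x₀ d K hβ hd hdx hK
  refine ⟨1, 1, M ^ (-(1 / (β + 1))) / 2 / (1 + Real.exp C), one_pos, one_pos, by positivity,
    fun L hL n δ T hδ hT hTt hcond => ?_⟩
  refine le_liminf_of_le (by isBoundedDefault) ?_
  have hρ : ∃ ρ : ℝ, 0 < ρ ∧ ρ ≤ 1 ∧ ρ < x₀ - d :=
    ⟨min 1 ((x₀ - d) / 2), lt_min one_pos (by linarith), min_le_left _ _,
      (min_le_right _ _).trans_lt (by linarith)⟩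
  obtain ⟨ρ, hρ0, hρ1, hρd⟩ := hρ
  have hε : Tendsto (fun k => T k ^ (-(1 / 2) : ℝ)) atTop (𝓝 0) :=
    (tendsto_rpow_neg_atTop (by norm_num)).comp hTt
  have hεJ : ∀ᶠ k in atTop, T k ^ (-(1 / 2) : ℝ) * J ≤ K := by
    have := hε.mul_const J
    rw [zero_mul] at this
    exact this.eventually_le_const hK
  have ha : Tendsto (fun k => (L / M * T k ^ (1 / 2 : ℝ)) ^ (1 / (β + 1))) atTop atTop :=
    (tendsto_rpow_atTop (by positivity)).comp
      (((tendsto_rpow_atTop (by norm_num)).comp hTt).const_mul_atTop (by positivity))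
  filter_upwards [hcond, hεJ, hTt.eventually_gt_atTop 0, ha.eventually_ge_atTop a₀,
    hTt.eventually_gt_atTop (ρ ^ (-2 * β - 2) / L ^ 2)] with k hk hkJ hTk hak hTρ
  -- If `δ k ≥ ρ`, the second condition would bound `T k` by `ρ ^ (-2β - 2) / L ^ 2`, which `T k`
  -- eventually exceeds.
  have hδρ : δ k < ρ := by
    by_contra hc
    push Not at hc
    have h1 : δ k ^ (-2 * β - 2) ≤ ρ ^ (-2 * β - 2) :=
      Real.rpow_le_rpow_of_nonpos hρ0 hc (by linarith)
    rw [div_lt_iff₀ (by positivity)] at hTρ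
    linarith [hk.2]
  -- This makes `ε² T = 1`, and the choice of `a` turns the Hölder constraint `ε M a ^ (β + 1) ≤ L`
  -- into an equality.
  set ε := T k ^ (-(1 / 2) : ℝ) with hεd
  set a := (L / M * T k ^ (1 / 2 : ℝ)) ^ (1 / (β + 1)) with had
  have hε0 : 0 < ε := Real.rpow_pos_of_pos hTk _
  have hεT : ε * T k ^ (1 / 2 : ℝ) = 1 := by
    rw [hεd, ← Real.rpow_add hTk]
    norm_num
  have hβ1 : β + 1 ≠ 0 := by positivity
  have haβ : a ^ (β + 1) = L / M * T k ^ (1 / 2 : ℝ) := by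
    rw [had, ← Real.rpow_mul (by positivity), one_div_mul_cancel hβ1, Real.rpow_one]
  have hmain := hlow L (δ k) ε a (n k) (hδ k) (hδρ.le.trans hρ1) (hδρ.trans hρd) hε0 hkJ hak (by
    rw [haβ]
    have : ε * (M * (L / M * T k ^ (1 / 2 : ℝ))) = L * (ε * T k ^ (1 / 2 : ℝ)) := by field_simp
    rw [this, hεT, mul_one])
  have hε2 : ε ^ 2 * ((n k : ℝ) * δ k) = 1 := by
    rw [← hT k, hεd, ← Real.rpow_natCast, ← Real.rpow_mul hTk.le]
    nth_rewrite 2 [← Real.rpow_one (T k)]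
    rw [← Real.rpow_add hTk]
    norm_num
  rw [hε2, mul_one] at hmain
  refine le_trans ?_ (mul_le_mul_right hmain _)
  have h1 : (1 : ℝ≥0∞) + ENNReal.ofReal (Real.exp C) = ENNReal.ofReal (1 + Real.exp C) := by
    rw [ENNReal.ofReal_add zero_le_one (Real.exp_pos _).le, ENNReal.ofReal_one]
  rw [h1, ← ENNReal.ofReal_div_of_pos (by positivity), ← ENNReal.ofReal_mul (by positivity)]
  refine ENNReal.ofReal_le_ofReal (le_of_eq ?_)
  have h2 : a = L ^ (1 / (β + 1)) * M ^ (-(1 / (β + 1))) * T k ^ (1 / 2 * (1 / (β + 1))) := by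
    rw [had, Real.mul_rpow (by positivity) (by positivity), Real.div_rpow hL.le hM.le,
      ← Real.rpow_mul hTk.le, Real.rpow_neg hM.le]
    rfl
  have h3 : L ^ (-(1 / (β + 1))) * L ^ (1 / (β + 1)) = 1 := by
    rw [← Real.rpow_add hL]
    simp
  have h4 : T k ^ (β / (2 * β + 2)) * ε * T k ^ (1 / 2 * (1 / (β + 1))) = 1 := by
    rw [hεd, ← Real.rpow_add hTk, ← Real.rpow_add hTk]
    have : β / (2 * β + 2) + -(1 / 2) + 1 / 2 * (1 / (β + 1)) = 0 := by
      field_simp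
      ring
    rw [this, Real.rpow_zero]
  rw [h2]
  calc M ^ (-(1 / (β + 1))) / 2 / (1 + Real.exp C)
      = (L ^ (-(1 / (β + 1))) * L ^ (1 / (β + 1)))
        * (T k ^ (β / (2 * β + 2)) * ε * T k ^ (1 / 2 * (1 / (β + 1))))
        * (M ^ (-(1 / (β + 1))) / 2 / (1 + Real.exp C)) := by rw [h3, h4, one_mul, one_mul]
    _ = _ := by ring
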